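/- Let $d\ge 1$. For $n\ge 0$ let $$\mathcal Q_n=\Big\{\prod_{i=1}^d[k_i2^{-n},(k_i+1)2^{-n}] : 0\le k_i\le 2^n-1\Big\}$$ be the family of closed dyadic cubes of order $n$ in $[0,1]^d$. For every $n\ge 1$ let $\{Z_n(Q): Q\in\mathcal Q_n\}$ be random variables with values in $\{0,1\}$, all defined on one probability space $(\Omega,\mathscr B,\mathbb P)$; no independence is assumed. Let $$A(n)=\bigcup_{Q\in\mathcal Q_n,\ Z_n(Q)=1}Q,\qquad A=\limsup_{n\to\infty}A(n)=\bigcap_{m\ge 1}\bigcup_{n\ge m}A(n),$$ and put $P_n(Q)=\mathbb P(Z_n(Q)=1)$. With the convention $\log_2 0=-\infty$, let $$\gamma_1=-\limsup_{n\to\infty}\frac{\log_2\big(\max_{Q\in\mathcal Q_n}P_n(Q)\big)}{n},\qquad \gamma_2=-\limsup_{n\to\infty}\frac{\log_2\big(\min_{Q\in\mathcal Q_n}P_n(Q)\big)}{n}\qquad(\gamma_1,\gamma_2\in[0,\infty]);$$ the corresponding limits need not exist. Let $\delta\ge 0$ be a real number such that the following Correlation Condition holds: for every $\epsilon>0$,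 $$\limsup_{n\to\infty}\frac1n\log_2 f(n,\epsilon)\le\delta,\qquad f(n,\epsilon)=\max_{Q\in\mathcal Q_n}\#\big\{Q'\in\mathcal Q_n:\operatorname{Cov}(Z_n(Q),Z_n(Q'))\ge\epsilon P_n(Q)P_n(Q')\big\}.$$ Let $\dim_{\rm H}$ denote the Hausdorff dimension and $\dim_{\rm P}$ the packing dimension, that is, $$\dim_{\rm P}(G)=\inf\Big\{\sup_{n}\overline{\dim}_{\rm B}(G_n): G\subset\bigcup_{n=1}^\infty G_n\Big\},\qquad \overline{\dim}_{\rm B}(E)=\limsup_{r\to0^+}\frac{\log N_r(E)}{-\log r},$$ where $N_r(E)$ is the least number of closed balls of radius $r$ that cover $E$. Then for every analytic set $G\subset[0,1]^d$: 1. if $\dim_{\rm P}(G)<\gamma_1$, then $\mathbb P(A\cap G\neq\varnothing)=0$; 2. if $\dim_{\rm H}(G)>\gamma_2+\delta$, then $\mathbb P(A\cap G\neq\varnothing)=1$. (In both cases the event $\{A\cap G\ne\varnothing\}$ is measurable with respect to the completion of $\mathbb P$.) -/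

import Mathlib

open MeasureTheory ProbabilityTheory Filter Set Topology
open scoped ENNReal NNReal

noncomputable section

namespace LimsupRandomFractal

/-- The unit cube `[0,1]^d` in Euclidean space. -/
def unitCube (d : ℕ) : Set (EuclideanSpace ℝ (Fin d)) :=
  {x | ∀ i, 0 ≤ x i ∧ x i ≤ 1}

/-- The positions `(k_1, …, k_d)`, `0 ≤ k_i ≤ 2 ^ n - 1`, of the dyadic cubes of order `n`
in `[0,1]^d`; distinct positions give distinct cubes, so this type stands for `𝒬_n`. -/
abbrev Pos (d n : ℕ) : Type := Fin d → Fin (2 ^ n)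

/-- The closed dyadic cube `∏ i, [k_i 2^{-n}, (k_i + 1) 2^{-n}]`. -/
def dyadicCube {d n : ℕ} (k : Pos d n) : Set (EuclideanSpace ℝ (Fin d)) :=
  {x | ∀ i, ((k i : ℕ) : ℝ) / 2 ^ n ≤ x i ∧ x i ≤ (((k i : ℕ) : ℝ) + 1) / 2 ^ n}

/-- Binary logarithm on `[0, ∞]`, with `log₂ 0 = -∞` and `log₂ ∞ = ∞`. -/
def log2 (x : ℝ≥0∞) : EReal := ENNReal.log x / ((Real.log 2 : ℝ) : EReal)

section Model

variable {Ω : Type*} [MeasurableSpace Ω] {d : ℕ}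

/-- `A(n)`, the union of the chosen cubes of order `n`. -/
def chosenUnion (Z : (n : ℕ) → Pos d n → Ω → ℝ) (n : ℕ) (ω : Ω) :
    Set (EuclideanSpace ℝ (Fin d)) :=
  ⋃ (k : Pos d n) (_ : Z n k ω = 1), dyadicCube k

/-- The limsup random fractal `A = limsup A(n)` (the points lying in infinitely many `A(n)`). -/
def limsupFractal (Z : (n : ℕ) → Pos d n → Ω → ℝ) (ω : Ω) : Set (EuclideanSpace ℝ (Fin d)) :=
  limsup (fun n => chosenUnion Z n ω) atTop

/-- `P_n(Q) = ℙ(Z_n(Q) = 1)`. -/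
def prob (μ : Measure Ω) (Z : (n : ℕ) → Pos d n → Ω → ℝ) (n : ℕ) (k : Pos d n) : ℝ≥0∞ :=
  μ {ω | Z n k ω = 1}

/-- `γ₁ = - limsup (log₂ (max_Q P_n(Q))) / n`, with values in `[-∞, ∞]`. -/
def gammaOne (μ : Measure Ω) (Z : (n : ℕ) → Pos d n → Ω → ℝ) : EReal :=
  -limsup (fun n : ℕ => log2 (⨆ k : Pos d n, prob μ Z n k) / ((n : ℝ) : EReal)) atTop

/-- `γ₂ = - limsup (log₂ (min_Q P_n(Q))) / n`, with values in `[-∞, ∞]`. -/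
def gammaTwo (μ : Measure Ω) (Z : (n : ℕ) → Pos d n → Ω → ℝ) : EReal :=
  -limsup (fun n : ℕ => log2 (⨅ k : Pos d n, prob μ Z n k) / ((n : ℝ) : EReal)) atTop

/-- `f(n, ε) = max_Q #{Q' : Cov(Z_n(Q), Z_n(Q')) ≥ ε P_n(Q) P_n(Q')}`. -/
def corrCount (μ : Measure Ω) (Z : (n : ℕ) → Pos d n → Ω → ℝ) (n : ℕ) (ε : ℝ) : ℕ :=
  Finset.univ.sup fun k : Pos d n =>
    Set.ncard {k' : Pos d n |
      ε * (prob μ Z n k).toReal * (prob μ Z n k').toReal ≤ cov[Z n k, Z n k'; μ]}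

/-- The Correlation Condition with constant `δ`. -/
def CorrelationCondition (μ : Measure Ω) (Z : (n : ℕ) → Pos d n → Ω → ℝ) (δ : ℝ) : Prop :=
  ∀ ε : ℝ, 0 < ε →
    limsup (fun n : ℕ => log2 (corrCount μ Z n ε : ℝ≥0∞) / ((n : ℝ) : EReal)) atTop ≤ (δ : EReal)

end Model

section Dimension

variable {X : Type*} [PseudoEMetricSpace X]

/-- Upper box dimension `limsup_{r → 0+} log N_r(G) / (- log r)`, where `N_r(G)` is the least
number of closed balls of radius `r` that cover `G` (so the empty set gets `-∞`). -/
def upperBoxDim (G : Set X) : EReal :=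
  limsup (fun r : ℝ≥0 =>
      ENNReal.log (Metric.externalCoveringNumber r G : ℝ≥0∞) / ((-Real.log r : ℝ) : EReal))
    (𝓝[>] (0 : ℝ≥0))

/-- Packing dimension: the infimum of `sup_n` of the upper box dimensions of `C n`, over all
countable covers `(C n)` of `G`. -/
def packingDim (G : Set X) : EReal :=
  ⨅ (C : ℕ → Set X) (_ : G ⊆ ⋃ n, C n), ⨆ n, upperBoxDim (C n)

end Dimension

end LimsupRandomFractal

end

open LimsupRandomFractal

/-! Part 1 is a first moment argument. If the upper box dimension of `C` is below `t < t' < γ₁`,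
then for large `n` at most `4 ^ d * 2 ^ (n t)` cubes meet `C`, each chosen with probability below `2
^ (-n t')`; Borel–Cantelli applies, and countable covers pass to packing dimension.

Part 2 has two halves. Second moment (`ae_exists_hitting`): if `dimH E > s > γ₂ + δ`, then at all
large `n` more than `2 ^ (n s)` cubes meet `E`. At the infinitely many `n` where all probabilities
exceed `2 ^ (-n c)`, Chebyshev makes it unlikely that none of these cubes is chosen. So almost
surely `A(n)` meets `E` for arbitrarily large `n`, but perhaps at different points. Baire category
supplies a common point: parametrise `G` by a Polish space in which preimages of cubes are open, and
restrict to a closed `F` whose relatively open pieces all have images of dimension above `s`. Almost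
surely each union over `n ≥ m` is then open and dense in `F`. -/

namespace LimsupRandomFractal

/-! ### Counting dyadic cubes that meet a set -/

section DyadicCubes
lemma log_two_rpow (y : ℝ) :
    ENNReal.log ((2 : ℝ≥0∞) ^ y) = ((y * Real.log 2 : ℝ) : EReal) := by
  have h : ENNReal.log (2 : ℝ≥0∞) = ((Real.log 2 : ℝ) : EReal) := by
    simpa using ENNReal.log_of_nnreal (x := 2) (by norm_num)
  rw [ENNReal.log_rpow, h, EReal.coe_mul]

lemma log2_div_lt_iff {x : ℝ≥0∞} {n : ℕ} (hn : 1 ≤ n) {t : ℝ} :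
    log2 x / ((n : ℝ) : EReal) < (t : EReal) ↔ x < 2 ^ ((n : ℝ) * t) := by
  have hn' : (0 : ℝ) < n := by exact_mod_cast hn
  have h2 : 0 < Real.log 2 := Real.log_pos one_lt_two
  rw [EReal.div_lt_iff (by exact_mod_cast hn') (EReal.coe_ne_top _), log2,
    EReal.div_lt_iff (by exact_mod_cast h2) (EReal.coe_ne_top _), ← EReal.coe_mul,
    ← EReal.coe_mul, ← ENNReal.log_lt_log_iff, log_two_rpow, mul_comm t]

lemma lt_log2_div_iff {x : ℝ≥0∞} {n : ℕ} (hn : 1 ≤ n) {t : ℝ} :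
    (t : EReal) < log2 x / ((n : ℝ) : EReal) ↔ 2 ^ ((n : ℝ) * t) < x := by
  have hn' : (0 : ℝ) < n := by exact_mod_cast hn
  have h2 : 0 < Real.log 2 := Real.log_pos one_lt_two
  rw [EReal.lt_div_iff (by exact_mod_cast hn') (EReal.coe_ne_top _), log2,
    EReal.lt_div_iff (by exact_mod_cast h2) (EReal.coe_ne_top _), ← EReal.coe_mul,
    ← EReal.coe_mul, ← ENNReal.log_lt_log_iff, log_two_rpow, mul_comm t]

variable {d : ℕ}

open Classical in
/-- The dyadic cubes of order `n` that meet `E`. -/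
noncomputable def hitting (n : ℕ) (E : Set (EuclideanSpace ℝ (Fin d))) : Finset (Pos d n) :=
  Finset.univ.filter fun k => (dyadicCube k ∩ E).Nonempty

@[simp] lemma mem_hitting {n : ℕ} {E : Set (EuclideanSpace ℝ (Fin d))} {k : Pos d n} :
    k ∈ hitting n E ↔ (dyadicCube k ∩ E).Nonempty := by
  simp [hitting]

lemma card_filter_fin_le_four {N : ℕ} (a : ℝ) :
    (Finset.univ.filter fun j : Fin N => a - 2 ≤ ((j : ℕ) : ℝ) ∧ ((j : ℕ) : ℝ) ≤ a + 1).card ≤ 4 := by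
  have h : (Finset.univ.filter fun j : Fin N => a - 2 ≤ ((j : ℕ) : ℝ) ∧
      ((j : ℕ) : ℝ) ≤ a + 1).card ≤ (Finset.Icc ⌈a - 2⌉ ⌊a + 1⌋).card := by
    refine Finset.card_le_card_of_injOn (fun j => ((j : ℕ) : ℤ)) ?_ ?_
    · intro j hj
      simp only [Finset.coe_filter, Finset.mem_univ, true_and, mem_ofPred_eq] at hj
      simp only [Finset.coe_Icc, mem_Icc, Int.ceil_le, Int.le_floor, Int.cast_natCast]
      exact hj
    · intro i _ j _ hij
      exact Fin.ext (by simpa using hij)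
  refine h.trans ?_
  rw [Int.card_Icc]
  have h1 : ((⌈a - 2⌉ : ℤ) : ℝ) ≥ a - 2 := Int.le_ceil _
  have h2 : ((⌊a + 1⌋ : ℤ) : ℝ) ≤ a + 1 := Int.floor_le _
  have h3 : ⌊a + 1⌋ - ⌈a - 2⌉ ≤ 3 := by
    have : ((⌊a + 1⌋ - ⌈a - 2⌉ : ℤ) : ℝ) ≤ 3 := by push_cast; linarith
    exact_mod_cast this
  omega

/-- In each coordinate the index of such a cube lies in an interval of length 3, which contains at
most four integers. -/
lemma card_hitting_closedEBall_le (n : ℕ) (c : EuclideanSpace ℝ (Fin d)) :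
    (hitting n {x | edist x c ≤ (((2 ^ n)⁻¹ : ℝ≥0) : ℝ≥0∞)}).card ≤ 4 ^ d := by
  classical
  have hsub : hitting n {x | edist x c ≤ (((2 ^ n)⁻¹ : ℝ≥0) : ℝ≥0∞)} ⊆
      Fintype.piFinset fun i => Finset.univ.filter fun j : Fin (2 ^ n) =>
        2 ^ n * c i - 2 ≤ ((j : ℕ) : ℝ) ∧ ((j : ℕ) : ℝ) ≤ 2 ^ n * c i + 1 := by
    intro k hk
    obtain ⟨x, hx, hxc⟩ := mem_hitting.1 hk
    rw [Fintype.mem_piFinset]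
    intro i
    have h1 : dist x c ≤ (2 ^ n)⁻¹ := by
      have : nndist x c ≤ (2 ^ n)⁻¹ := by
        have h := hxc
        rw [mem_ofPred_eq, edist_nndist] at h
        exact_mod_cast h
      exact_mod_cast this
    have h2 : |x i - c i| ≤ (2 ^ n)⁻¹ := by
      refine le_trans ?_ h1
      rw [dist_eq_norm]
      simpa using PiLp.norm_apply_le (x - c) i
    have hp : (0 : ℝ) < 2 ^ n := by positivity
    obtain ⟨h3, h4⟩ := hx i
    rw [div_le_iff₀ hp] at h3
    rw [le_div_iff₀ hp] at h4
    rw [abs_le] at h2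
    have h5 : (x i - c i) * 2 ^ n ≤ 1 := by
      calc (x i - c i) * 2 ^ n ≤ (2 ^ n)⁻¹ * 2 ^ n := by gcongr; exact h2.2
        _ = 1 := inv_mul_cancel₀ hp.ne'
    have h6 : -1 ≤ (x i - c i) * 2 ^ n := by
      calc (-1 : ℝ) = -(2 ^ n)⁻¹ * 2 ^ n := by rw [neg_mul, inv_mul_cancel₀ hp.ne']
        _ ≤ (x i - c i) * 2 ^ n := by gcongr; exact h2.1
    simp only [Finset.mem_filter, Finset.mem_univ, true_and]
    constructor <;> nlinarith
  refine (Finset.card_le_card hsub).trans ?_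
  rw [Fintype.card_piFinset]
  refine (Finset.prod_le_pow_card _ _ 4 fun i _ => card_filter_fin_le_four _).trans ?_
  simp

lemma card_hitting_le (n : ℕ) (E : Set (EuclideanSpace ℝ (Fin d))) :
    ((hitting n E).card : ℝ≥0∞) ≤
      4 ^ d * (Metric.externalCoveringNumber (2 ^ n)⁻¹ E : ℝ≥0∞) := by
  classical
  by_cases htop : Metric.externalCoveringNumber (2 ^ n)⁻¹ E = ⊤
  · rw [htop]
    simp
  obtain ⟨C, hC, hcard⟩ : ∃ C : Set (EuclideanSpace ℝ (Fin d)), Metric.IsCover (2 ^ n)⁻¹ E C ∧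
      C.encard = Metric.externalCoveringNumber (2 ^ n)⁻¹ E := by
    have : Nonempty {C : Set (EuclideanSpace ℝ (Fin d)) // Metric.IsCover (2 ^ n)⁻¹ E C} :=
      ⟨⟨E, Metric.IsCover.refl _ _⟩⟩
    obtain ⟨C, hC⟩ := ENat.exists_eq_iInf
      (fun C : {C : Set (EuclideanSpace ℝ (Fin d)) // Metric.IsCover (2 ^ n)⁻¹ E C} =>
        (C : Set (EuclideanSpace ℝ (Fin d))).encard)
    exact ⟨C, C.2, by rw [hC, Metric.externalCoveringNumber, iInf_subtype]⟩
  rw [← hcard] at htop ⊢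
  have hfin : C.Finite := Set.encard_ne_top_iff.1 htop
  have hsub : hitting n E ⊆ hfin.toFinset.biUnion fun c =>
      hitting n {x | edist x c ≤ (((2 ^ n)⁻¹ : ℝ≥0) : ℝ≥0∞)} := by
    intro k hk
    obtain ⟨x, hx, hxE⟩ := mem_hitting.1 hk
    obtain ⟨c, hc, hxc⟩ := hC hxE
    simp only [Finset.mem_biUnion, Set.Finite.mem_toFinset, mem_hitting]
    exact ⟨c, hc, x, hx, hxc⟩
  have h := (Finset.card_le_card hsub).trans
    (Finset.card_biUnion_le_card_mul _ _ _ fun c _ => card_hitting_closedEBall_le n c)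
  rw [hfin.encard_eq_coe_toFinset_card, mul_comm]
  exact_mod_cast h

lemma ediam_dyadicCube_le {n : ℕ} (k : Pos d n) :
    Metric.ediam (dyadicCube k) ≤ ENNReal.ofReal (√d * (2 ^ n)⁻¹) := by
  refine Metric.ediam_le fun x hx y hy => ?_
  rw [edist_dist]
  refine ENNReal.ofReal_le_ofReal ?_
  rw [EuclideanSpace.dist_eq]
  have h : ∀ i, dist (x i) (y i) ^ 2 ≤ ((2 ^ n)⁻¹ : ℝ) ^ 2 := by
    intro i
    obtain ⟨h1, h2⟩ := hx i
    obtain ⟨h3, h4⟩ := hy i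
    rw [add_div, one_div] at h2 h4
    refine pow_le_pow_left₀ dist_nonneg ?_ 2
    rw [Real.dist_eq, abs_le]
    constructor <;> linarith
  refine Real.sqrt_le_iff.2 ⟨by positivity, (Finset.sum_le_sum fun i _ => h i).trans ?_⟩
  rw [mul_pow, Real.sq_sqrt (Nat.cast_nonneg d)]
  simp

lemma exists_mem_dyadicCube {x : EuclideanSpace ℝ (Fin d)} (hx : x ∈ unitCube d) (n : ℕ) :
    ∃ k : Pos d n, x ∈ dyadicCube k := by
  have hp : (0 : ℝ) < 2 ^ n := by positivity
  have h : ∀ i, ∃ j : Fin (2 ^ n), ((j : ℕ) : ℝ) / 2 ^ n ≤ x i ∧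
      x i ≤ (((j : ℕ) : ℝ) + 1) / 2 ^ n := by
    intro i
    obtain ⟨h0, h1⟩ := hx i
    by_cases hlt : x i = 1
    -- At the endpoint 1 the floor would give the inadmissible index `2 ^ n`.
    · refine ⟨⟨2 ^ n - 1, by have := Nat.two_pow_pos n; omega⟩, ?_, ?_⟩
      · rw [hlt, div_le_one hp, Nat.cast_sub Nat.one_le_two_pow]
        simp
      · rw [hlt, one_le_div hp, Nat.cast_sub Nat.one_le_two_pow]
        simp
    · have hlt' : x i < 1 := lt_of_le_of_ne h1 hlt
      have hnn : 0 ≤ x i * 2 ^ n := by positivity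
      refine ⟨⟨⌊x i * 2 ^ n⌋₊, ?_⟩, ?_, ?_⟩
      · rw [Nat.floor_lt hnn]
        push_cast
        nlinarith
      · rw [div_le_iff₀ hp]
        exact Nat.floor_le hnn
      · rw [le_div_iff₀ hp]
        exact (Nat.lt_floor_add_one _).le
  choose k hk using h
  exact ⟨k, hk⟩

lemma isClosed_dyadicCube {n : ℕ} (k : Pos d n) : IsClosed (dyadicCube k) := by
  simp only [dyadicCube, ofPred_forall]
  refine isClosed_iInter fun i => ?_
  have hc : Continuous fun x : EuclideanSpace ℝ (Fin d) => x i := by fun_prop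
  exact (isClosed_le continuous_const hc).inter (isClosed_le hc continuous_const)

/-- The lower box dimension dominates the Hausdorff dimension. -/
lemma eventually_lt_card_hitting {E : Set (EuclideanSpace ℝ (Fin d))} (hE : E ⊆ unitCube d)
    {s : ℝ≥0} (hs : (s : ℝ≥0∞) < dimH E) :
    ∀ᶠ n : ℕ in atTop, (2 : ℝ≥0∞) ^ ((n : ℝ) * s) < (hitting n E).card := by
  -- Otherwise covers by at most `2 ^ (n s)` cubes, along a subsequence, bound the `s`-dimensional
  -- Hausdorff measure by `√d ^ s`, although it is infinite below the dimension.
  by_contra hcon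
  rw [not_eventually] at hcon
  simp only [not_lt] at hcon
  obtain ⟨φ, hφ, hle⟩ := extraction_of_frequently_atTop hcon
  have htop := hausdorffMeasure_of_lt_dimH hs
  refine absurd htop (ne_of_lt ?_)
  have hr : Tendsto (fun n : ℕ => ENNReal.ofReal (√d * (2 ^ φ n)⁻¹)) atTop (𝓝 0) := by
    rw [← ENNReal.ofReal_zero]
    refine ENNReal.tendsto_ofReal ?_
    have h1 : Tendsto (fun n : ℕ => ((2 : ℝ) ^ n)⁻¹) atTop (𝓝 0) := by
      simpa using tendsto_pow_atTop_nhds_zero_of_lt_one (r := (1 / 2 : ℝ)) (by norm_num) (by norm_num)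
    simpa using (h1.comp hφ.tendsto_atTop).const_mul √d
  refine (Measure.hausdorffMeasure_le_liminf_sum (ι := fun n => hitting (φ n) E) (s : ℝ) E
    (fun n : ℕ => ENNReal.ofReal (√d * (2 ^ φ n)⁻¹)) hr (fun n k => dyadicCube k.1)
    (Eventually.of_forall fun n k => ediam_dyadicCube_le _)
    (Eventually.of_forall fun n x hx => ?_)).trans_lt ?_
  · obtain ⟨k, hk⟩ := exists_mem_dyadicCube (hE hx) (φ n)
    exact mem_iUnion.2 ⟨⟨k, mem_hitting.2 ⟨x, hk, hx⟩⟩, hk⟩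
  · refine (liminf_le_of_le (a := ENNReal.ofReal √d ^ (s : ℝ)) (by isBoundedDefault)
      fun b hb => ?_).trans_lt (ENNReal.rpow_lt_top_of_nonneg s.2 ENNReal.ofReal_ne_top)
    obtain ⟨n, hn⟩ := hb.exists
    refine hn.trans ?_
    calc ∑ k : hitting (φ n) E, Metric.ediam (dyadicCube k.1) ^ (s : ℝ)
        ≤ ∑ k : hitting (φ n) E, ENNReal.ofReal (√d * (2 ^ φ n)⁻¹) ^ (s : ℝ) :=
          Finset.sum_le_sum fun k _ =>
            ENNReal.rpow_le_rpow (ediam_dyadicCube_le _) s.2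
      _ = (hitting (φ n) E).card * ENNReal.ofReal (√d * (2 ^ φ n)⁻¹) ^ (s : ℝ) := by simp
      _ ≤ 2 ^ ((φ n : ℝ) * s) * ENNReal.ofReal (√d * (2 ^ φ n)⁻¹) ^ (s : ℝ) := by
          gcongr
          exact hle n
      _ = ENNReal.ofReal √d ^ (s : ℝ) := by
          rw [ENNReal.rpow_mul, ← ENNReal.mul_rpow_of_nonneg _ _ s.coe_nonneg]
          congr 1
          rw [ENNReal.ofReal_mul (by positivity), ENNReal.ofReal_inv_of_pos (by positivity),
            ENNReal.ofReal_pow (by norm_num), ENNReal.rpow_natCast, mul_left_comm]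
          simp only [ENNReal.ofReal_ofNat]
          rw [ENNReal.mul_inv_cancel (by simp) (by simp), mul_one]

end DyadicCubes

/-! ### First moment and Borel–Cantelli -/

section UpperBound
variable {d : ℕ}

lemma eventually_externalCoveringNumber_lt {X : Type*} [PseudoEMetricSpace X] {E : Set X} {t : ℝ}
    (ht : upperBoxDim E < (t : EReal)) :
    ∀ᶠ n : ℕ in atTop,
      (Metric.externalCoveringNumber (2 ^ n)⁻¹ E : ℝ≥0∞) < 2 ^ ((n : ℝ) * t) := by
  have h1 := eventually_lt_of_limsup_lt ht
  have h2 : Tendsto (fun n : ℕ => ((2 : ℝ≥0) ^ n)⁻¹) atTop (𝓝[>] 0) := by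
    refine tendsto_nhdsWithin_iff.2 ⟨?_, Eventually.of_forall fun n => by simp⟩
    simp_rw [← inv_pow]
    exact NNReal.tendsto_pow_atTop_nhds_zero_of_lt_one (by
      rw [← NNReal.coe_lt_coe]; norm_num)
  filter_upwards [h2.eventually h1, eventually_ge_atTop 1] with n hn hn1
  rw [← log2_div_lt_iff hn1, log2, EReal.div_div]
  convert! hn using 2
  rw [← EReal.coe_mul]
  congr 1
  push_cast
  rw [Real.log_inv, Real.log_pow]
  ring

variable {Ω : Type*}

lemma mem_limsupFractal {Z : (n : ℕ) → Pos d n → Ω → ℝ} {ω : Ω}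
    {x : EuclideanSpace ℝ (Fin d)} :
    x ∈ limsupFractal Z ω ↔ ∃ᶠ n in atTop, ∃ k : Pos d n, Z n k ω = 1 ∧ x ∈ dyadicCube k := by
  simp [limsupFractal, mem_limsup_iff_frequently_mem, chosenUnion]

variable [MeasurableSpace Ω]

lemma measure_limsupFractal_inter_eq_zero (μ : Measure Ω) (Z : (n : ℕ) → Pos d n → Ω → ℝ)
    {C : Set (EuclideanSpace ℝ (Fin d))} (h : upperBoxDim C < gammaOne μ Z) :
    μ {ω | (limsupFractal Z ω ∩ C).Nonempty} = 0 := by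
  obtain ⟨t, ht, htγ⟩ := EReal.lt_iff_exists_real_btwn.1 h
  obtain ⟨t', htt', ht'⟩ := EReal.lt_iff_exists_real_btwn.1 htγ
  have htt : t < t' := by exact_mod_cast htt'
  have hP : ∀ᶠ n : ℕ in atTop, (⨆ k : Pos d n, prob μ Z n k) < 2 ^ ((n : ℝ) * -t') := by
    have h1 : limsup (fun n : ℕ => log2 (⨆ k : Pos d n, prob μ Z n k) / ((n : ℝ) : EReal)) atTop
        < ((-t' : ℝ) : EReal) := by
      rw [EReal.coe_neg]
      exact EReal.lt_neg_comm.1 ht'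
    filter_upwards [eventually_lt_of_limsup_lt h1, eventually_ge_atTop 1] with n hn hn1
    exact (log2_div_lt_iff hn1).1 hn
  obtain ⟨N, hN⟩ := eventually_atTop.1 (hP.and (eventually_externalCoveringNumber_lt ht))
  set q : ℝ≥0∞ := 2 ^ (t - t') with hq
  have hq1 : q < 1 := ENNReal.rpow_lt_one_of_one_lt_of_neg (by norm_num) (by linarith)
  have hbound : ∀ n, N ≤ n → μ {ω | ∃ k ∈ hitting n C, Z n k ω = 1} ≤ 4 ^ d * q ^ n := by
    intro n hn
    obtain ⟨h1, h2⟩ := hN n hn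
    calc μ {ω | ∃ k ∈ hitting n C, Z n k ω = 1}
        = μ (⋃ k ∈ hitting n C, {ω | Z n k ω = 1}) := by
          congr 1
          ext ω
          simp
      _ ≤ ∑ k ∈ hitting n C, prob μ Z n k := measure_biUnion_finset_le _ _
      _ ≤ ∑ k ∈ hitting n C, 2 ^ ((n : ℝ) * -t') :=
          Finset.sum_le_sum fun k _ => (le_iSup (fun k => prob μ Z n k) k).trans h1.le
      _ = (hitting n C).card * 2 ^ ((n : ℝ) * -t') := by simp
      _ ≤ (4 ^ d * 2 ^ ((n : ℝ) * t)) * 2 ^ ((n : ℝ) * -t') := by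
          gcongr
          exact (card_hitting_le n C).trans (by gcongr)
      _ = 4 ^ d * q ^ n := by
          rw [mul_assoc, ← ENNReal.rpow_add _ _ (by norm_num) (by norm_num), hq,
            ← ENNReal.rpow_natCast (2 ^ (t - t')) n, ← ENNReal.rpow_mul]
          congr 2
          ring
  -- The clause `N ≤ n` removes the finitely many terms without a bound.
  have hsum : ∑' n, μ {ω | N ≤ n ∧ ∃ k ∈ hitting n C, Z n k ω = 1} ≠ ∞ := by
    refine ne_top_of_le_ne_top (b := ∑' n, 4 ^ d * q ^ n) ?_ (ENNReal.tsum_le_tsum fun n => ?_)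
    · rw [ENNReal.tsum_mul_left, ENNReal.tsum_geometric]
      exact ENNReal.mul_ne_top (by simp) (ENNReal.inv_ne_top.2 (tsub_pos_of_lt hq1).ne')
    · by_cases hn : N ≤ n
      · simpa [hn] using hbound n hn
      · simp [hn]
  refine measure_mono_null ?_ (measure_setOfPred_frequently_eq_zero hsum)
  rintro ω ⟨x, hx, hxC⟩
  refine ((mem_limsupFractal.1 hx).and_eventually (eventually_ge_atTop N)).mono ?_
  rintro n ⟨⟨k, hk, hxk⟩, hn⟩
  exact ⟨hn, k, mem_hitting.2 ⟨x, hxk, hxC⟩, hk⟩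

theorem measure_limsupFractal_inter_eq_zero_of_packingDim_lt (μ : Measure Ω)
    (Z : (n : ℕ) → Pos d n → Ω → ℝ) {G : Set (EuclideanSpace ℝ (Fin d))}
    (h : packingDim G < gammaOne μ Z) :
    μ {ω | (limsupFractal Z ω ∩ G).Nonempty} = 0 := by
  simp only [packingDim, iInf_lt_iff] at h
  obtain ⟨C, hC, hlt⟩ := h
  refine measure_mono_null ?_ (measure_iUnion_null fun n =>
    measure_limsupFractal_inter_eq_zero μ Z ((le_iSup (fun n => upperBoxDim (C n)) n).trans_lt hlt))
  rintro ω ⟨x, hx, hxG⟩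
  obtain ⟨n, hn⟩ := mem_iUnion.1 (hC hxG)
  exact mem_iUnion.2 ⟨n, x, hx, hn⟩

end UpperBound

/-! ### Second moment method -/

section LowerBound
section SecondMoment

variable {Ω ι : Type*} [MeasurableSpace Ω] {μ : Measure Ω}

lemma integral_of_zero_or_one {X : Ω → ℝ} (hm : Measurable X) (hv : ∀ ω, X ω = 0 ∨ X ω = 1) :
    ∫ ω, X ω ∂μ = (μ {ω | X ω = 1}).toReal := by
  have h : X = ({ω | X ω = 1} : Set Ω).indicator 1 := by
    ext ω
    rcases hv ω with h | h <;> simp [indicator, h]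
  conv_lhs => rw [h]
  exact integral_indicator_one (hm (measurableSet_singleton 1))

variable [IsProbabilityMeasure μ]

lemma memLp_of_zero_or_one {X : Ω → ℝ} (hm : Measurable X) (hv : ∀ ω, X ω = 0 ∨ X ω = 1) :
    MemLp X 2 μ :=
  MemLp.of_bound hm.aestronglyMeasurable 1
    (Eventually.of_forall fun ω => by rcases hv ω with h | h <;> simp [h])

/-- Pointwise `X * Y ≤ X`, and the subtracted product of means is nonnegative. -/
lemma covariance_le_of_zero_or_one {X Y : Ω → ℝ} (hX : Measurable X)
    (hXv : ∀ ω, X ω = 0 ∨ X ω = 1) (hY : Measurable Y) (hYv : ∀ ω, Y ω = 0 ∨ Y ω = 1) :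
    cov[X, Y; μ] ≤ (μ {ω | X ω = 1}).toReal := by
  rw [covariance_eq_sub (memLp_of_zero_or_one hX hXv) (memLp_of_zero_or_one hY hYv),
    integral_of_zero_or_one hX hXv, integral_of_zero_or_one hY hYv,
    ← integral_of_zero_or_one hX hXv]
  have h : ∫ ω, (X * Y) ω ∂μ ≤ ∫ ω, X ω ∂μ := by
    refine integral_mono
      ((memLp_of_zero_or_one hX hXv).integrable_mul (memLp_of_zero_or_one hY hYv))
      ((memLp_of_zero_or_one hX hXv).integrable (by norm_num)) fun ω => ?_
    rcases hXv ω with h | h <;> rcases hYv ω with h' | h' <;> simp [h, h']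
  have h' : 0 ≤ (∫ ω, X ω ∂μ) * (μ {ω | Y ω = 1}).toReal := by
    rw [integral_of_zero_or_one hX hXv]
    positivity
  linarith

open Classical in
/-- Second moment bound on the probability that no event of a weakly correlated family occurs. -/
lemma measure_forall_ne_one_le {X : ι → Ω → ℝ} {T : Finset ι} (hm : ∀ i, Measurable (X i))
    (hv : ∀ i ω, X i ω = 0 ∨ X i ω = 1) {ε : ℝ} (hε : 0 ≤ ε) {f : ℝ}
    (hf : ∀ i ∈ T, ((T.filter fun j => ε * (μ {ω | X i ω = 1}).toReal *
      (μ {ω | X j ω = 1}).toReal ≤ cov[X i, X j; μ]).card : ℝ) ≤ f)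
    (hpos : 0 < ∑ i ∈ T, (μ {ω | X i ω = 1}).toReal) :
    μ {ω | ∀ i ∈ T, X i ω ≠ 1} ≤
      ENNReal.ofReal (ε + f / ∑ i ∈ T, (μ {ω | X i ω = 1}).toReal) := by
  set p : ι → ℝ := fun i => (μ {ω | X i ω = 1}).toReal with hp
  set M : ℝ := ∑ i ∈ T, p i with hM
  have hL : ∀ i, MemLp (X i) 2 μ := fun i => memLp_of_zero_or_one (hm i) (hv i)
  have hp0 : ∀ i, 0 ≤ p i := fun i => ENNReal.toReal_nonneg
  have hmean : ∫ ω, (∑ i ∈ T, X i) ω ∂μ = M := by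
    simp only [Finset.sum_apply]
    rw [integral_finsetSum _ fun i _ => (hL i).integrable (by norm_num)]
    exact Finset.sum_congr rfl fun i _ => integral_of_zero_or_one (hm i) (hv i)
  have hvar : variance (∑ i ∈ T, X i) μ ≤ ε * M ^ 2 + f * M := by
    rw [variance_sum' fun i _ => hL i]
    calc ∑ i ∈ T, ∑ j ∈ T, cov[X i, X j; μ]
        ≤ ∑ i ∈ T, (ε * p i * M + f * p i) := by
          refine Finset.sum_le_sum fun i hi => ?_
          -- Weakly correlated pairs cost `ε * p i * p j`; each of the at most `f` others costs at
          -- most an extra `p i`.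
          calc ∑ j ∈ T, cov[X i, X j; μ]
              ≤ ∑ j ∈ T, (ε * p i * p j +
                  if ε * p i * p j ≤ cov[X i, X j; μ] then p i else 0) := by
                refine Finset.sum_le_sum fun j _ => ?_
                have h0 : 0 ≤ ε * p i * p j := mul_nonneg (mul_nonneg hε (hp0 i)) (hp0 j)
                split_ifs with h
                · have := covariance_le_of_zero_or_one (μ := μ) (hm i) (hv i) (hm j) (hv j)
                  linarith
                · linarith
            _ = ε * p i * M + (T.filter fun j => ε * p i * p j ≤ cov[X i, X j; μ]).card * p i := by
                rw [Finset.sum_add_distrib, ← Finset.mul_sum, ← Finset.sum_filter,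
                  Finset.sum_const, nsmul_eq_mul]
            _ ≤ ε * p i * M + f * p i := by
                have := mul_le_mul_of_nonneg_right (hf i hi) (hp0 i)
                gcongr
      _ = ε * M ^ 2 + f * M := by
          rw [Finset.sum_add_distrib, ← Finset.sum_mul, ← Finset.mul_sum, ← Finset.mul_sum]
          ring
  -- If no `X i` equals 1, the sum is 0 and deviates from its mean by exactly `M`.
  have hcheb := meas_ge_le_variance_div_sq (μ := μ) (memLp_finsetSum' T fun i _ => hL i) hpos
  refine (measure_mono fun ω hω => ?_).trans (hcheb.trans (ENNReal.ofReal_le_ofReal ?_))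
  · have h0 : (∑ i ∈ T, X i) ω = 0 := by
      rw [Finset.sum_apply]
      exact Finset.sum_eq_zero fun i hi => (hv i ω).resolve_right (hω i hi)
    rw [mem_ofPred_eq, hmean, h0, zero_sub, abs_neg]
    exact le_abs_self _
  · rw [div_le_iff₀ (by positivity)]
    calc variance (∑ i ∈ T, X i) μ ≤ ε * M ^ 2 + f * M := hvar
      _ = (ε + f / M) * M ^ 2 := by
        have : M ≠ 0 := hpos.ne'
        field_simp

end SecondMoment

variable {Ω : Type*} [MeasurableSpace Ω] {d : ℕ}

open Classical in
lemma card_filter_le_corrCount (μ : Measure Ω) (Z : (n : ℕ) → Pos d n → Ω → ℝ) (n : ℕ) (ε : ℝ)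
    (T : Finset (Pos d n)) (k : Pos d n) :
    (T.filter fun k' => ε * (prob μ Z n k).toReal * (prob μ Z n k').toReal ≤
      cov[Z n k, Z n k'; μ]).card ≤ corrCount μ Z n ε := by
  refine le_trans ?_ (Finset.le_sup (f := fun k : Pos d n => Set.ncard {k' : Pos d n |
      ε * (prob μ Z n k).toReal * (prob μ Z n k').toReal ≤ cov[Z n k, Z n k'; μ]})
      (Finset.mem_univ k))
  rw [← Set.ncard_coe_finset]
  exact Set.ncard_le_ncard (fun k' hk' => (Finset.mem_filter.1 hk').2) (Set.toFinite _)

lemma ae_exists_hitting (μ : Measure Ω) [IsProbabilityMeasure μ]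
    {Z : (n : ℕ) → Pos d n → Ω → ℝ}
    (hZ_meas : ∀ n : ℕ, 1 ≤ n → ∀ k : Pos d n, Measurable (Z n k))
    (hZ_val : ∀ n : ℕ, 1 ≤ n → ∀ (k : Pos d n) (ω : Ω), Z n k ω = 0 ∨ Z n k ω = 1)
    {δ : ℝ} (hcorr : CorrelationCondition μ Z δ) {s : ℝ≥0}
    (hs : gammaTwo μ Z + (δ : EReal) < ((s : ℝ) : EReal))
    {E : Set (EuclideanSpace ℝ (Fin d))} (hE : E ⊆ unitCube d) (hsE : (s : ℝ≥0∞) < dimH E)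
    (m : ℕ) :
    ∀ᵐ ω ∂μ, ∃ n, m ≤ n ∧ ∃ k ∈ hitting n E, Z n k ω = 1 := by
  classical
  obtain ⟨c, hc, hcs⟩ : ∃ c : ℝ, gammaTwo μ Z < (c : EReal) ∧ c + δ < s := by
    have h1 : gammaTwo μ Z < ((s - δ : ℝ) : EReal) := by
      rw [EReal.coe_sub]
      exact EReal.lt_sub_iff_add_lt (by simp) (by simp) |>.2 hs
    obtain ⟨c, hc, hcs⟩ := EReal.lt_iff_exists_real_btwn.1 h1
    refine ⟨c, hc, ?_⟩
    have : c < s - δ := by exact_mod_cast hcs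
    linarith
  -- Half the slack goes to `b`, so the count `2 ^ (n b)` over the mean `2 ^ (n (s - c))` still
  -- decays.
  obtain ⟨b, hδb, hcb⟩ : ∃ b : ℝ, δ < b ∧ c + b < s := by
    refine ⟨δ + (s - δ - c) / 2, ?_, ?_⟩ <;> linarith
  have hfreq : ∃ᶠ n : ℕ in atTop,
      (2 : ℝ≥0∞) ^ ((n : ℝ) * -c) < ⨅ k : Pos d n, prob μ Z n k := by
    have h1 : ((-c : ℝ) : EReal) <
        limsup (fun n : ℕ => log2 (⨅ k : Pos d n, prob μ Z n k) / ((n : ℝ) : EReal)) atTop := by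
      rw [EReal.coe_neg]
      exact EReal.neg_lt_comm.1 hc
    refine ((frequently_lt_of_lt_limsup (by isBoundedDefault) h1).and_eventually
      (eventually_ge_atTop 1)).mono fun n hn => ?_
    exact (lt_log2_div_iff hn.2).1 hn.1
  have hnull : μ {ω | ∀ n, m ≤ n → ∀ k ∈ hitting n E, Z n k ω ≠ 1} = 0 := by
    refine nonpos_iff_eq_zero.1 (ENNReal.le_of_forall_pos_le_add fun ε hε _ => ?_)
    rw [zero_add]
    -- Half of `ε` is the correlation threshold, half bounds the count over the mean.
    have hε2 : (0 : ℝ) < ε / 2 := by positivity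
    have hcount : ∀ᶠ n : ℕ in atTop,
        (corrCount μ Z n (ε / 2) : ℝ≥0∞) < 2 ^ ((n : ℝ) * b) := by
      have h1 := (hcorr (ε / 2) hε2).trans_lt (EReal.coe_lt_coe_iff.2 hδb)
      filter_upwards [eventually_lt_of_limsup_lt h1, eventually_ge_atTop 1] with n hn hn1
      exact (log2_div_lt_iff hn1).1 hn
    have hsmall : ∀ᶠ n : ℕ in atTop, (2 : ℝ) ^ ((n : ℝ) * (b + c - s)) < ε / 2 := by
      have h1 : Tendsto (fun n : ℕ => ((2 : ℝ) ^ (b + c - s)) ^ n) atTop (𝓝 0) :=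
        tendsto_pow_atTop_nhds_zero_of_lt_one (by positivity)
          (Real.rpow_lt_one_of_one_lt_of_neg (by norm_num) (by linarith))
      filter_upwards [h1.eventually_lt_const hε2] with n hn
      rwa [mul_comm, Real.rpow_mul (by norm_num), Real.rpow_natCast]
    obtain ⟨n, hinf, hcnt, hsm, hhit, hmn, hn1⟩ := (hfreq.and_eventually
      (hcount.and (hsmall.and ((eventually_lt_card_hitting hE hsE).and
        ((eventually_ge_atTop m).and (eventually_ge_atTop 1)))))).exists
    have hp : ∀ k, (2 : ℝ) ^ ((n : ℝ) * -c) ≤ (prob μ Z n k).toReal := by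
      intro k
      have := ENNReal.toReal_mono (measure_ne_top μ _) (hinf.le.trans (iInf_le _ k))
      rwa [← ENNReal.toReal_rpow] at this
    have hcnt' : (corrCount μ Z n (ε / 2) : ℝ) ≤ 2 ^ ((n : ℝ) * b) := by
      have := ENNReal.toReal_mono (ENNReal.rpow_ne_top_of_ne_zero (by norm_num) (by norm_num)) hcnt.le
      rwa [← ENNReal.toReal_rpow] at this
    have hhit' : (2 : ℝ) ^ ((n : ℝ) * s) ≤ (hitting n E).card := by
      have := ENNReal.toReal_mono (ENNReal.natCast_ne_top _) hhit.le
      rwa [← ENNReal.toReal_rpow] at this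
    have hM : (2 : ℝ) ^ ((n : ℝ) * (s - c)) ≤ ∑ k ∈ hitting n E, (prob μ Z n k).toReal := by
      calc (2 : ℝ) ^ ((n : ℝ) * (s - c)) = 2 ^ ((n : ℝ) * s) * 2 ^ ((n : ℝ) * -c) := by
            rw [← Real.rpow_add (by norm_num)]
            congr 1
            ring
        _ ≤ (hitting n E).card * 2 ^ ((n : ℝ) * -c) := by gcongr
        _ = ∑ k ∈ hitting n E, (2 : ℝ) ^ ((n : ℝ) * -c) := by simp
        _ ≤ _ := Finset.sum_le_sum fun k _ => hp k
    have hM0 : 0 < ∑ k ∈ hitting n E, (prob μ Z n k).toReal :=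
      lt_of_lt_of_le (by positivity) hM
    have hmain := measure_forall_ne_one_le (μ := μ) (T := hitting n E) (hZ_meas n hn1)
      (hZ_val n hn1) hε2.le (f := corrCount μ Z n (ε / 2)) (fun k _ =>
        Nat.cast_le.2 (card_filter_le_corrCount μ Z n (ε / 2) (hitting n E) k)) hM0
    have hsub : {ω | ∀ n, m ≤ n → ∀ k ∈ hitting n E, Z n k ω ≠ 1} ⊆
        {ω | ∀ k ∈ hitting n E, Z n k ω ≠ 1} := fun ω hω => hω n hmn
    refine (measure_mono hsub).trans (hmain.trans ?_)
    rw [← ENNReal.ofReal_coe_nnreal]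
    refine ENNReal.ofReal_le_ofReal ?_
    have hquot : (corrCount μ Z n (ε / 2) : ℝ) / ∑ k ∈ hitting n E, (prob μ Z n k).toReal
        ≤ 2 ^ ((n : ℝ) * (b + c - s)) := by
      rw [div_le_iff₀ hM0]
      calc (corrCount μ Z n (ε / 2) : ℝ) ≤ 2 ^ ((n : ℝ) * b) := hcnt'
        _ = 2 ^ ((n : ℝ) * (b + c - s)) * 2 ^ ((n : ℝ) * (s - c)) := by
            rw [← Real.rpow_add (by norm_num)]
            congr 1
            ring
        _ ≤ _ := by gcongr
    calc _ ≤ (ε : ℝ) / 2 + 2 ^ ((n : ℝ) * (b + c - s)) := by gcongr; exact hquot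
      _ ≤ ε := by linarith
  filter_upwards [measure_eq_zero_iff_ae_notMem.1 hnull] with ω hω
  simpa using hω

end LowerBound

/-! ### A common point by Baire category -/

section BaireCategory
/-- An analytic set is an image of a Polish space under a map for which the preimages of
countably many prescribed closed sets are open. -/
lemma exists_polishSpace_isOpen_preimage {Y : Type*} [TopologicalSpace Y] {G : Set Y}
    (hG : AnalyticSet G) (hne : G.Nonempty) {ι : Type*} [Countable ι] {C : ι → Set Y}
    (hC : ∀ i, IsClosed (C i)) :
    ∃ (t : TopologicalSpace (ℕ → ℕ)) (φ : (ℕ → ℕ) → Y), @PolishSpace _ t ∧ range φ = G ∧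
      ∀ i, IsOpen[t] (φ ⁻¹' C i) := by
  rw [AnalyticSet] at hG
  obtain ⟨φ, hφ, hrange⟩ := hG.resolve_left hne.ne_empty
  -- Each closed preimage becomes clopen in some finer Polish topology, and countably many of these
  -- have a common Polish refinement.
  have hcl : ∀ i, PolishSpace.IsClopenable (φ ⁻¹' C i) := fun i => ((hC i).preimage hφ).isClopenable
  choose t ht htp _ hto using hcl
  obtain ⟨t', ht', -, hp⟩ := PolishSpace.exists_polishSpace_forall_le t ht htp
  exact ⟨t', φ, hp, hrange, fun i => ht' i _ (hto i)⟩

/-- Removing the relatively open pieces with an image of small dimension leaves a closed set, all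
of whose nonempty relatively open subsets have an image of large dimension. -/
lemma exists_isClosed_forall_lt_dimH_image {X Y : Type*} [TopologicalSpace X]
    [SecondCountableTopology X] [EMetricSpace Y] {φ : X → Y} {s : ℝ≥0∞}
    (h : s < dimH (range φ)) :
    ∃ F : Set X, IsClosed F ∧ F.Nonempty ∧
      ∀ U, IsOpen U → (U ∩ F).Nonempty → s < dimH (φ '' (U ∩ F)) := by
  set B := TopologicalSpace.countableBasis X with hB
  have hbasis := TopologicalSpace.isBasis_countableBasis X
  set S : Set (Set X) := {U ∈ B | dimH (φ '' U) ≤ s} with hS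
  have hScount : S.Countable := (TopologicalSpace.countable_countableBasis X).mono (sep_subset _ _)
  -- Countable stability of `dimH`: the discarded part has a small image, so it is not everything
  -- and cannot account for a large piece.
  have hV : dimH (φ '' ⋃₀ S) ≤ s := by
    rw [sUnion_eq_biUnion, image_iUnion₂, dimH_bUnion hScount]
    exact iSup₂_le fun U hU => hU.2
  refine ⟨(⋃₀ S)ᶜ, (isOpen_sUnion fun U hU => hbasis.isOpen hU.1).isClosed_compl, ?_, ?_⟩
  · rw [nonempty_compl]
    intro huniv
    rw [huniv, image_univ] at hV
    exact absurd h hV.not_gt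
  · rintro U hU ⟨x, hxU, hxF⟩
    by_contra hle
    rw [not_lt] at hle
    obtain ⟨W, hW, hxW, hWU⟩ := hbasis.exists_subset_of_mem_open hxU hU
    refine hxF ⟨W, ⟨hW, ?_⟩, hxW⟩
    have hsub : φ '' W ⊆ φ '' (U ∩ (⋃₀ S)ᶜ) ∪ φ '' ⋃₀ S := by
      rw [← image_union]
      refine image_mono fun y hy => ?_
      by_cases hyS : y ∈ ⋃₀ S
      · exact Or.inr hyS
      · exact Or.inl ⟨hWU hy, hyS⟩
    exact (dimH_mono hsub).trans (by rw [dimH_union]; exact max_le hle hV)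

variable {Ω : Type*} [MeasurableSpace Ω] {d : ℕ}

theorem ae_limsupFractal_inter_nonempty (μ : Measure Ω) [IsProbabilityMeasure μ]
    {Z : (n : ℕ) → Pos d n → Ω → ℝ}
    (hZ_meas : ∀ n : ℕ, 1 ≤ n → ∀ k : Pos d n, Measurable (Z n k))
    (hZ_val : ∀ n : ℕ, 1 ≤ n → ∀ (k : Pos d n) (ω : Ω), Z n k ω = 0 ∨ Z n k ω = 1)
    {δ : ℝ} (hcorr : CorrelationCondition μ Z δ) {s : ℝ≥0}
    (hs : gammaTwo μ Z + (δ : EReal) < ((s : ℝ) : EReal))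
    {G : Set (EuclideanSpace ℝ (Fin d))} (hG : AnalyticSet G) (hG_sub : G ⊆ unitCube d)
    (hsG : (s : ℝ≥0∞) < dimH G) :
    ∀ᵐ ω ∂μ, (limsupFractal Z ω ∩ G).Nonempty := by
  have hne : G.Nonempty := by
    by_contra h
    rw [not_nonempty_iff_eq_empty.1 h, dimH_empty] at hsG
    exact not_lt_zero hsG
  obtain ⟨t, φ, hpol, hrange, hopen⟩ := exists_polishSpace_isOpen_preimage hG hne
    (C := fun i : Σ n, Pos d n => dyadicCube i.2) fun i => isClosed_dyadicCube i.2
  let := t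
  obtain ⟨F, hF, hFne, hFdim⟩ := exists_isClosed_forall_lt_dimH_image (φ := φ) (hrange ▸ hsG)
  have hunit : ∀ U : Set (ℕ → ℕ), φ '' U ⊆ unitCube d := fun U =>
    (image_subset_range φ U).trans (hrange ▸ hG_sub)
  -- Countably many pairs `(U, m)`, hence a single null set.
  have hae : ∀ᵐ ω ∂μ, ∀ U ∈ TopologicalSpace.countableBasis (ℕ → ℕ), ∀ m : ℕ,
      (U ∩ F).Nonempty → ∃ n, m ≤ n ∧ ∃ k ∈ hitting n (φ '' (U ∩ F)), Z n k ω = 1 := by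
    rw [ae_ball_iff (TopologicalSpace.countable_countableBasis _)]
    intro U hU
    rw [ae_all_iff]
    intro m
    by_cases hUF : (U ∩ F).Nonempty
    · filter_upwards [ae_exists_hitting μ hZ_meas hZ_val hcorr hs (hunit _)
        (hFdim U (TopologicalSpace.isOpen_of_mem_countableBasis hU) hUF) m] with ω hω _
      exact hω
    · exact Eventually.of_forall fun ω h => absurd h hUF
  filter_upwards [hae] with ω hω
  have : PolishSpace F := hF.polishSpace
  have : Nonempty F := hFne.to_subtype
  set W : ℕ → Set F := fun m =>
    ⋃ (n : ℕ) (_ : m ≤ n) (k : Pos d n) (_ : Z n k ω = 1), {x : F | φ x ∈ dyadicCube k} with hW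
  have hWo : ∀ m, IsOpen (W m) := fun m =>
    isOpen_iUnion fun n => isOpen_iUnion fun _ => isOpen_iUnion fun k => isOpen_iUnion fun _ =>
      (hopen ⟨n, k⟩).preimage continuous_subtype_val
  have hWd : ∀ m, Dense (W m) := by
    intro m
    rw [dense_iff_inter_open]
    rintro V hV ⟨x, hxV⟩
    obtain ⟨V', hV', rfl⟩ := isOpen_induced_iff.1 hV
    obtain ⟨U, hU, hxU, hUV⟩ := (TopologicalSpace.isBasis_countableBasis
      (ℕ → ℕ)).exists_subset_of_mem_open hxV hV'
    obtain ⟨n, hmn, k, hk, hZk⟩ := hω U hU m ⟨x, hxU, x.2⟩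
    obtain ⟨_, hy, y, ⟨hyU, hyF⟩, rfl⟩ := mem_hitting.1 hk
    refine ⟨⟨y, hyF⟩, hUV hyU, ?_⟩
    simp only [hW, mem_iUnion]
    exact ⟨n, hmn, k, hZk, hy⟩
  obtain ⟨x, hx⟩ := (dense_iInter_of_isOpen_nat hWo hWd).nonempty
  refine ⟨φ x, mem_limsupFractal.2 (frequently_atTop.2 fun m => ?_), hrange ▸ mem_range_self _⟩
  have hxm := mem_iInter.1 hx m
  simp only [hW, mem_iUnion] at hxm
  obtain ⟨n, hmn, k, hZk, hy⟩ := hxm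
  exact ⟨n, hmn, k, hZk, hy⟩

end BaireCategory

end LimsupRandomFractal

theorem theorem1p1 {Ω : Type*} [MeasurableSpace Ω] (μ : Measure Ω) [IsProbabilityMeasure μ]
    {d : ℕ} (Z : (n : ℕ) → Pos d n → Ω → ℝ)
    (hZ_meas : ∀ n : ℕ, 1 ≤ n → ∀ k : Pos d n, Measurable (Z n k))
    (hZ_val : ∀ n : ℕ, 1 ≤ n → ∀ (k : Pos d n) (ω : Ω), Z n k ω = 0 ∨ Z n k ω = 1)
    (δ : ℝ) (hδ : 0 ≤ δ) (hcorr : CorrelationCondition μ Z δ)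
    (G : Set (EuclideanSpace ℝ (Fin d))) (hG : AnalyticSet G) (hG_sub : G ⊆ unitCube d) :
    (packingDim G < gammaOne μ Z →
      μ {ω | (limsupFractal Z ω ∩ G).Nonempty} = 0) ∧
    (gammaTwo μ Z + (δ : EReal) < (dimH G : EReal) →
      NullMeasurableSet {ω | (limsupFractal Z ω ∩ G).Nonempty} μ ∧
      μ {ω | (limsupFractal Z ω ∩ G).Nonempty} = 1) := by
  refine ⟨measure_limsupFractal_inter_eq_zero_of_packingDim_lt μ Z, fun h => ?_⟩
  obtain ⟨s, hs, hsG⟩ : ∃ s : ℝ≥0, gammaTwo μ Z + (δ : EReal) < ((s : ℝ) : EReal) ∧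
      (s : ℝ≥0∞) < dimH G := by
    -- Nonnegativity lets the intermediate real exponent be taken in `ℝ≥0`.
    have h0 : 0 ≤ gammaTwo μ Z + (δ : EReal) := by
      refine add_nonneg ?_ (by exact_mod_cast hδ)
      rw [gammaTwo, EReal.le_neg, neg_zero]
      refine limsup_le_of_le (by isBoundedDefault) (Eventually.of_forall fun n => ?_)
      refine EReal.div_nonpos_of_nonpos_of_nonneg (EReal.div_nonpos_of_nonpos_of_nonneg
        (ENNReal.log_le_zero_iff.2 ((iInf_le _ fun _ => 0).trans prob_le_one)) ?_) (by simp)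
      exact_mod_cast (Real.log_pos one_lt_two).le
    obtain ⟨c, hc, hcG⟩ := EReal.lt_iff_exists_real_btwn.1 h
    have hc0 : 0 ≤ c := by exact_mod_cast h0.trans hc.le
    lift c to ℝ≥0 using hc0
    refine ⟨c, hc, ?_⟩
    exact EReal.coe_ennreal_lt_coe_ennreal_iff.1 hcG
  have hae := ae_limsupFractal_inter_nonempty μ hZ_meas hZ_val hcorr hs hG hG_sub hsG
  have heq : {ω | (limsupFractal Z ω ∩ G).Nonempty} =ᵐ[μ] (univ : Set Ω) :=
    eventuallyEq_univ.2 hae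
  exact ⟨MeasurableSet.univ.nullMeasurableSet.congr heq.symm, by rw [measure_congr heq, measure_univ]⟩
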